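/- Let $F,H\in\mathbb{R}^{n\times n}$ and $\alpha_1,\alpha_2\in\mathbb{R}$. Suppose that $H$ has rank one, $H=bc$ with $b\in\mathbb{R}^{n\times 1}$ a column vector and $c\in\mathbb{R}^{1\times n}$ a row vector, and that $(F,b)$ is controllable, i.e. the matrix $[\,b,Fb,\dots,F^{n-1}b\,]$ has rank $n$. Suppose that $F+\alpha_1H$ and $F+\alpha_2H$ are unstable (each has an eigenvalue with positive real part) and that neither has an eigenvalue on the imaginary axis (in particular, $0$ is not an eigenvalue of either). Then the following three conditions are equivalent: 1. there is a common real symmetric matrix $P=P^T$ such that $P(F+\alpha_iH)+(F+\alpha_iH)^TP$ is negative definite for $i=1,2$; 2. the matrix $(F+\alpha_1H)(F+\alpha_2H)$ has no negative real eigenvalue; 3. $1-\operatorname{Re}\{(\alpha_2-\alpha_1)\,c\,(j\omega I-F-\alpha_1H)^{-1}b\}>0$ for all $\omega\in\mathbb{R}$, where $j$ is the imaginary unit. Moreover, if any one of these conditions holds, then $F+((1-\lambda)\alpha_1+\lambda\alpha_2)H$ is unstable (has an eigenvalue with positive real part) for every $\lambda\in(0,1)$. -/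

import Mathlib

/-- A real square matrix regarded as a complex matrix. -/
def toComplexMatrix {n : ℕ} (A : Matrix (Fin n) (Fin n) ℝ) : Matrix (Fin n) (Fin n) ℂ :=
  A.map (fun x : ℝ => (x : ℂ))

/-- `μ` is a (complex) eigenvalue of the real square matrix `A`. -/
def IsComplexEigenvalue {n : ℕ} (A : Matrix (Fin n) (Fin n) ℝ) (μ : ℂ) : Prop :=
  Module.End.HasEigenvalue (Matrix.toLin' (toComplexMatrix A)) μ

/-- `A` has no eigenvalue on the imaginary axis (in particular `0` is not an eigenvalue). -/
def NoImaginaryEigenvalue {n : ℕ} (A : Matrix (Fin n) (Fin n) ℝ) : Prop :=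
  ∀ μ : ℂ, IsComplexEigenvalue A μ → μ.re ≠ 0

/-- `A` is unstable: some eigenvalue has positive real part. For a matrix without eigenvalues on
the imaginary axis this is the negation of (Hurwitz) stability; in general it is stronger. -/
def IsUnstable {n : ℕ} (A : Matrix (Fin n) (Fin n) ℝ) : Prop :=
  ∃ μ : ℂ, IsComplexEigenvalue A μ ∧ 0 < μ.re

/-- The controllability matrix `[b, F b, …, F ^ (n - 1) b]` of the pair `(F, b)`. -/
def controllabilityMatrix {n : ℕ} (F : Matrix (Fin n) (Fin n) ℝ) (b : Fin n → ℝ) :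
    Matrix (Fin n) (Fin n) ℝ :=
  Matrix.of fun i k => ((F ^ (k : ℕ)).mulVec b) i

/-- The pair `(F, b)` is controllable: its controllability matrix has full rank. -/
def IsControllable {n : ℕ} (F : Matrix (Fin n) (Fin n) ℝ) (b : Fin n → ℝ) : Prop :=
  (controllabilityMatrix F b).rank = n

/-- The real symmetric matrix `M` is negative definite, `M < 0`. -/
def IsNegDef {n : ℕ} (M : Matrix (Fin n) (Fin n) ℝ) : Prop :=
  (-M).PosDef

/-- The scalar transfer function `c (s I - A)⁻¹ b`. -/
noncomputable def transferFunction {n : ℕ} (A : Matrix (Fin n) (Fin n) ℝ) (b c : Fin n → ℝ)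
    (s : ℂ) : ℂ :=
  dotProduct (fun i => (c i : ℂ))
    ((s • (1 : Matrix (Fin n) (Fin n) ℂ) - toComplexMatrix A)⁻¹.mulVec (fun i => (b i : ℂ)))

/-- There is a common symmetric `P` with `P A₁ + A₁ᵀ P < 0` and `P A₂ + A₂ᵀ P < 0`. -/
def HasCommonLyapunovMatrix {n : ℕ} (A₁ A₂ : Matrix (Fin n) (Fin n) ℝ) : Prop :=
  ∃ P : Matrix (Fin n) (Fin n) ℝ, P = P.transpose ∧
    IsNegDef (P * A₁ + A₁.transpose * P) ∧ IsNegDef (P * A₂ + A₂.transpose * P)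

/-- `M` has no negative real eigenvalue. -/
def NoNegativeRealEigenvalue {n : ℕ} (M : Matrix (Fin n) (Fin n) ℝ) : Prop :=
  ∀ r : ℝ, r < 0 → ¬ Module.End.HasEigenvalue (Matrix.toLin' M) r

/-! Write A = F + α₁H, δ = α₂ - α₁, so that F + α₂H = A + δbc; the three conditions are proved in a
cycle. 1 → 2: if A₁A₂x = rx with r < 0, put y = A₂x. The inequality for A₂ gives xᵀPy < 0, so yᵀPA₁y
= r yᵀPx > 0, against the inequality for A₁. 2 → 3: the frequency function is continuous and tends
to 1 at infinity, so if it is ever nonpositive it vanishes at some ν. Then p = Re (iν - A)⁻¹b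
satisfies A(A + δbc)p = -ν²p; the case ν = 0 is excluded because A + δbc is invertible. 3 → 1: this
is the strict Kalman–Yakubovich–Popov lemma, `Matrix.exists_symm_of_frequency_condition`. If no P
exists, Hahn–Banach gives a nonzero Z ≥ 0 orthogonal to all the P-terms; a factorization Z = BᵀB
turns orthogonality into a skew relation, which splits Z into solutions at single frequencies, where
the form is negative. Instability of the segment: Lyapunov inequalities with one P are preserved by
convex combinations, and for such a P instability amounts to P taking a negative value
(`IsUnstable.of_lyapunov`). -/

/-! ### Orthonormal bases adapted to a skew pair of operators -/

open Module in
/-- A linear isometry of a finite-dimensional complex inner product space is diagonalized by an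
orthonormal basis. -/
theorem LinearIsometry.exists_orthonormalBasis_eigenvectors {E : Type*} [NormedAddCommGroup E]
    [InnerProductSpace ℂ E] [FiniteDimensional ℂ E] (T : E →ₗᵢ[ℂ] E) :
    ∃ (e : OrthonormalBasis (Fin (finrank ℂ E)) ℂ E) (τ : Fin (finrank ℂ E) → ℂ),
      ∀ k, T (e k) = τ k • e k := by
  classical
  set U : E →ₗ[ℂ] E := T.toLinearMap with hU
  set V : E →ₗ[ℂ] E := LinearMap.adjoint U with hV
  have hVU : V * U = 1 := by
    ext x
    refine ext_inner_left ℂ fun y => ?_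
    simp [hV, hU, LinearMap.adjoint_inner_right]
  have hUV : U * V = 1 := mul_eq_one_comm.mp hVU
  -- U is unitary, hence normal: U + U† and i(U - U†) are commuting self-adjoint operators, and
  -- their joint eigenspaces diagonalize U.
  have hsA : (U + V).IsSymmetric := by
    intro x y
    simp only [LinearMap.add_apply, inner_add_left, inner_add_right]
    rw [hV, LinearMap.adjoint_inner_left, LinearMap.adjoint_inner_right, add_comm]
  have hsB : (Complex.I • (U - V)).IsSymmetric := by
    intro x y
    simp only [LinearMap.smul_apply, LinearMap.sub_apply, inner_smul_left, inner_smul_right,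
      inner_sub_left, inner_sub_right]
    rw [hV, LinearMap.adjoint_inner_left, LinearMap.adjoint_inner_right]
    simp only [Complex.conj_I]
    ring
  have hcomm : Commute (U + V) (Complex.I • (U - V)) := by
    apply Commute.smul_right
    show (U + V) * (U - V) = (U - V) * (U + V)
    simp only [add_mul, mul_sub, sub_mul, mul_add, hVU, hUV]
    abel
  have hint := LinearMap.IsSymmetric.directSum_isInternal_of_commute hsA hsB hcomm
  have horth := LinearMap.IsSymmetric.orthogonalFamily_eigenspace_inf_eigenspace hsA hsB
  have hfin := WellFoundedGT.finite_ne_bot_of_iSupIndep hint.submodule_iSupIndep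
  have : Fintype {i : ℂ × ℂ // End.eigenspace (U + V) i.2 ⊓
    End.eigenspace (Complex.I • (U - V)) i.1 ≠ ⊥} := hfin.fintype
  have hint' := DirectSum.isInternal_ne_bot_iff.mpr hint
  have horth' := horth.comp (γ := {i : ℂ × ℂ // End.eigenspace (U + V) i.2 ⊓
    End.eigenspace (Complex.I • (U - V)) i.1 ≠ ⊥}) (f := Subtype.val) Subtype.val_injective
  refine ⟨hint'.subordinateOrthonormalBasis rfl horth', fun k =>
    ((hint'.subordinateOrthonormalBasisIndex rfl k horth').1.2
      - Complex.I * (hint'.subordinateOrthonormalBasisIndex rfl k horth').1.1) / 2, fun k => ?_⟩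
  have hk := hint'.subordinateOrthonormalBasis_subordinate rfl k horth'
  set e := hint'.subordinateOrthonormalBasis rfl horth' k
  set p := (hint'.subordinateOrthonormalBasisIndex rfl k horth').1
  obtain ⟨h1, h2⟩ := hk
  have h1' : U e + V e = p.2 • e := by simpa using End.mem_eigenspace_iff.mp h1
  have h2' : Complex.I • (U e - V e) = p.1 • e := by simpa using End.mem_eigenspace_iff.mp h2
  have h3 : U e - V e = (-Complex.I * p.1) • e := by
    rw [mul_smul, ← h2', smul_smul]
    simp
  have h4 : (2 : ℂ) • U e = (p.2 - Complex.I * p.1) • e := by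
    rw [sub_eq_add_neg, ← neg_mul, add_smul, ← h1', ← h3, two_smul]
    abel
  show U e = ((p.2 - Complex.I * p.1) / 2) • e
  rw [div_eq_inv_mul, mul_smul, ← h4, smul_smul]
  simp

open Module in
/-- If `Y X† + X Y† = 0`, there is an orthonormal basis whose vectors are either in the kernel of
`X` or solve `Y e = iω X e` for a real `ω`. -/
theorem LinearMap.exists_orthonormalBasis_of_comp_adjoint_add_eq_zero {E W : Type*}
    [NormedAddCommGroup E] [InnerProductSpace ℂ E] [FiniteDimensional ℂ E]
    [NormedAddCommGroup W] [InnerProductSpace ℂ W] [FiniteDimensional ℂ W]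
    (X Y : E →ₗ[ℂ] W) (h : Y ∘ₗ adjoint X + X ∘ₗ adjoint Y = 0) :
    ∃ e : OrthonormalBasis (Fin (finrank ℂ E)) ℂ E,
      ∀ k, X (e k) = 0 ∨ ∃ ω : ℝ, Y (e k) = (Complex.I * ω) • X (e k) := by
  set F := adjoint (Y + X) with hF
  set G := adjoint (Y - X) with hG
  have hFG : (Y + X) ∘ₗ F = (Y - X) ∘ₗ G := by
    have : Y ∘ₗ adjoint X = - (X ∘ₗ adjoint Y) := eq_neg_of_add_eq_zero_left h
    simp only [hF, hG, map_add, map_sub, LinearMap.add_comp, LinearMap.sub_comp,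
      LinearMap.comp_add, LinearMap.comp_sub, this]
    abel
  -- `hFG` says F†F = G†G, so G w ↦ F w is a well-defined isometry on the range of G; it extends to
  -- all of E, and the eigenvectors of the extension form the basis.
  have hnorm : ∀ w, ‖F w‖ = ‖G w‖ := by
    intro w
    have : inner ℂ (F w) (F w) = inner ℂ (G w) (G w) := by
      conv_lhs => rw [hF, LinearMap.adjoint_inner_left]
      conv_rhs => rw [hG, LinearMap.adjoint_inner_left]
      rw [← hF, ← hG]
      exact congrArg (inner ℂ w) (LinearMap.congr_fun hFG w)
    rw [inner_self_eq_norm_sq_to_K, inner_self_eq_norm_sq_to_K] at this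
    have h2 : ‖F w‖ ^ 2 = ‖G w‖ ^ 2 := by exact_mod_cast this
    exact (sq_eq_sq₀ (norm_nonneg _) (norm_nonneg _)).mp h2
  have hker : LinearMap.ker G ≤ LinearMap.ker F := by
    intro w hw
    rw [LinearMap.mem_ker] at hw ⊢
    rw [← norm_eq_zero, hnorm, hw, norm_zero]
  let L₀ : LinearMap.range G →ₗ[ℂ] E :=
    ((LinearMap.ker G).liftQ F hker) ∘ₗ G.quotKerEquivRange.symm.toLinearMap
  have hL₀ : ∀ w, L₀ ⟨G w, G.mem_range_self w⟩ = F w := by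
    intro w
    simp only [L₀, LinearMap.comp_apply, LinearEquiv.coe_coe]
    rw [LinearMap.quotKerEquivRange_symm_apply_image]
    simp
  let L : LinearMap.range G →ₗᵢ[ℂ] E := ⟨L₀, by
    rintro ⟨_, w, rfl⟩
    exact (congrArg norm (hL₀ w)).trans (hnorm w)⟩
  have hT : ∀ w, L.extend (G w) = F w := fun w =>
    (L.extend_apply ⟨G w, G.mem_range_self w⟩).trans (hL₀ w)
  obtain ⟨e, τ, he⟩ := L.extend.exists_orthonormalBasis_eigenvectors
  refine ⟨e, fun k => ?_⟩
  have hτ : ‖τ k‖ = 1 := by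
    have h1 := L.extend.norm_map (e k)
    rw [he, norm_smul, e.orthonormal.1 k, mul_one] at h1
    exact h1
  have hsol : τ k • (Y + X) (e k) = (Y - X) (e k) := by
    refine ext_inner_right ℂ fun w => ?_
    rw [inner_smul_left, ← LinearMap.adjoint_inner_right, ← LinearMap.adjoint_inner_right,
      ← hF, ← hG, ← hT, ← L.extend.inner_map_map (e k) (G w), he, inner_smul_left]
  set σ := τ k
  -- Cayley transform: (1 + σ)/(1 - σ) is purely imaginary for |σ| = 1, and σ = 1 is the frequency
  -- at infinity, where X e = 0.
  have h1 : (1 - σ) • Y (e k) = (1 + σ) • X (e k) := by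
    simp only [LinearMap.add_apply, LinearMap.sub_apply, smul_add] at hsol
    rw [sub_smul, add_smul, one_smul, one_smul, sub_eq_iff_eq_add, eq_comm, add_assoc,
      add_comm (σ • _), hsol]
    abel
  by_cases hσ : σ = 1
  · left
    rw [hσ, sub_self, zero_smul] at h1
    exact (smul_eq_zero.mp h1.symm).resolve_left (by norm_num)
  · right
    have hσ' : 1 - σ ≠ 0 := sub_ne_zero.mpr (Ne.symm hσ)
    have h2 : Y (e k) = ((1 + σ) / (1 - σ)) • X (e k) := by
      rw [div_eq_inv_mul, mul_smul, ← h1, smul_smul, inv_mul_cancel₀ hσ', one_smul]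
    have hre : ((1 + σ) / (1 - σ)).re = 0 := by
      have hsq : σ.re * σ.re + σ.im * σ.im = 1 := by
        rw [← Complex.normSq_apply, Complex.normSq_eq_norm_sq, hτ, one_pow]
      rw [Complex.div_re, ← add_div]
      simp only [Complex.add_re, Complex.sub_re, Complex.add_im, Complex.sub_im, Complex.one_re,
        Complex.one_im]
      rw [show (1 + σ.re) * (1 - σ.re) + (0 + σ.im) * (0 - σ.im) = 0 by linarith, zero_div]
    refine ⟨((1 + σ) / (1 - σ)).im, ?_⟩
    rw [h2]
    congr 1
    apply Complex.ext <;> simp [hre]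

/-! ### Separation and the strict Kalman–Yakubovich–Popov lemma -/

open Matrix in
/-- A separating functional for the cone of matrices with negative quadratic form: if no member of
an affine family `M + V` has a negative quadratic form, then some nonzero positive semidefinite
matrix `Z` is trace-orthogonal to `V` and satisfies `0 ≤ tr (M Z)`. -/
theorem Matrix.exists_posSemidef_trace_of_forall_not_neg {ι : Type*} [Fintype ι] [DecidableEq ι]
    (M : Matrix ι ι ℝ) (V : Submodule ℝ (Matrix ι ι ℝ))
    (h : ∀ N ∈ V, ¬ ∀ z : ι → ℝ, z ≠ 0 → z ⬝ᵥ (M + N) *ᵥ z < 0) :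
    ∃ Z : Matrix ι ι ℝ, Z.PosSemidef ∧ Z ≠ 0 ∧ 0 ≤ (M * Z).trace ∧ ∀ N ∈ V, (N * Z).trace = 0 := by
  set D : Set (Matrix ι ι ℝ) := {N | ∀ z : ι → ℝ, z ≠ 0 → z ⬝ᵥ N *ᵥ z < 0} with hD
  set T : Set (Matrix ι ι ℝ) := {N | ∃ N' ∈ V, N = M + N'} with hT
  have hDconv : Convex ℝ D := by
    rintro A hA B hB s t hs ht hst z hz
    have h1 := hA z hz
    have h2 := hB z hz
    rw [add_mulVec, smul_mulVec, smul_mulVec, dotProduct_add, dotProduct_smul, dotProduct_smul,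
      smul_eq_mul, smul_eq_mul]
    rcases hs.eq_or_lt with rfl | hs
    · have : t = 1 := by linarith
      subst this
      linarith
    · nlinarith [mul_neg_of_pos_of_neg hs h1, mul_nonneg ht (neg_nonneg.mpr h2.le)]
  have hTconv : Convex ℝ T := by
    rintro _ ⟨A, hA, rfl⟩ _ ⟨B, hB, rfl⟩ s t hs ht hst
    refine ⟨s • A + t • B, V.add_mem (V.smul_mem _ hA) (V.smul_mem _ hB), ?_⟩
    rw [smul_add, smul_add, add_add_add_comm, ← add_smul, hst, one_smul]
  have hDopen : IsOpen D := by
    -- By homogeneity the unit sphere suffices, and its compactness makes the condition open.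
    have hD' : D = {N | ∀ z ∈ Metric.sphere (0 : ι → ℝ) 1, z ⬝ᵥ N *ᵥ z < 0} := by
      ext N
      refine ⟨fun hN z hz => hN z (by rintro rfl; simp at hz), fun hN z hz => ?_⟩
      have hz' : 0 < ‖z‖ := norm_pos_iff.mpr hz
      have h1 := hN (‖z‖⁻¹ • z) (by simp [norm_smul, hz'.ne'])
      rw [mulVec_smul, dotProduct_smul, smul_dotProduct, smul_eq_mul, smul_eq_mul] at h1
      by_contra hcon
      have := mul_nonneg (inv_nonneg.mpr hz'.le) (mul_nonneg (inv_nonneg.mpr hz'.le)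
        (not_lt.mp hcon))
      linarith
    rw [hD', isOpen_iff_mem_nhds]
    intro N hN
    have hcont : Continuous fun p : Matrix ι ι ℝ × (ι → ℝ) => p.2 ⬝ᵥ p.1 *ᵥ p.2 := by
      fun_prop
    exact (isCompact_sphere (0 : ι → ℝ) 1).eventually_forall_of_forall_eventually
      (P := fun (N : Matrix ι ι ℝ) (z : ι → ℝ) => z ⬝ᵥ N *ᵥ z < 0)
      fun z hz => hcont.continuousAt.eventually_lt continuousAt_const (hN z hz)
  have hdisj : Disjoint D T := by
    rw [Set.disjoint_left]
    rintro _ hN ⟨N, hNV, rfl⟩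
    exact h N hNV hN
  obtain ⟨f, u, hfD, hfT⟩ := geometric_hahn_banach_open hDconv hDopen hTconv hdisj
  have hDsmul : ∀ N ∈ D, ∀ t : ℝ, 0 < t → t • N ∈ D := by
    intro N hN t ht z hz
    rw [smul_mulVec, dotProduct_smul, smul_eq_mul]
    exact mul_neg_of_pos_of_neg ht (hN z hz)
  have hdot : ∀ z : ι → ℝ, z ≠ 0 → 0 < z ⬝ᵥ z := fun z hz => by
    simpa using (dotProduct_star_self_pos_iff (v := z)).mpr hz
  have hD1 : ∀ K : Matrix ι ι ℝ, (∀ z, z ⬝ᵥ K *ᵥ z ≤ 0) → ∀ ε : ℝ, 0 < ε → K - ε • 1 ∈ D := by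
    intro K hK ε hε z hz
    rw [sub_mulVec, smul_mulVec, one_mulVec, dotProduct_sub, dotProduct_smul, smul_eq_mul]
    nlinarith [hK z, mul_pos hε (hdot z hz)]
  have hneg1 : (0 - (1 : ℝ) • 1 : Matrix ι ι ℝ) ∈ D := hD1 0 (by simp) 1 one_pos
  have hfD' : ∀ N ∈ D, f N ≤ 0 := by
    intro N hN
    by_contra hcon
    push Not at hcon
    have h1 := hfD _ (hDsmul N hN ((|u| + 1) / f N) (by positivity))
    rw [map_smul, smul_eq_mul, div_mul_cancel₀ _ hcon.ne'] at h1
    linarith [le_abs_self u]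
  have hu : 0 ≤ u := by
    by_contra hcon
    push Not at hcon
    have h0 : f (0 - (1 : ℝ) • 1 : Matrix ι ι ℝ) < 0 := (hfD _ hneg1).trans hcon
    have h1 := hfD _ (hDsmul _ hneg1 (u / (2 * f (0 - (1 : ℝ) • 1 : Matrix ι ι ℝ)))
      (div_pos_of_neg_of_neg hcon (by linarith)))
    rw [map_smul, smul_eq_mul, div_mul_eq_mul_div, mul_div_mul_right _ _ h0.ne] at h1
    linarith
  have hM : u ≤ f M := by simpa using hfT M ⟨0, V.zero_mem, by simp⟩
  have hV : ∀ N ∈ V, f N = 0 := by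
    intro N hN
    by_contra hcon
    have h1 := hfT _ ⟨((u - f M - 1) / f N) • N, V.smul_mem _ hN, rfl⟩
    rw [map_add, map_smul, smul_eq_mul, div_mul_cancel₀ _ hcon] at h1
    linarith
  -- Passage to the closed cone, by letting ε → 0 in K - ε • 1.
  have hsq : ∀ K : Matrix ι ι ℝ, (∀ z, z ⬝ᵥ K *ᵥ z ≤ 0) → f K ≤ 0 := by
    intro K hK
    have h1 : ∀ ε : ℝ, 0 < ε → f K ≤ ε * f 1 := by
      intro ε hε
      have := hfD' _ (hD1 K hK ε hε)
      rw [map_sub, map_smul, smul_eq_mul] at this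
      linarith
    by_contra hcon
    push Not at hcon
    have h2 := h1 1 one_pos
    have h3 : 0 < f 1 := by linarith
    have h4 := h1 (f K / (2 * f 1)) (by positivity)
    rw [div_mul_eq_mul_div, mul_div_mul_right _ _ h3.ne'] at h4
    linarith
  set Z : Matrix ι ι ℝ := of fun i j => f (single j i 1) with hZ
  have hfZ : ∀ N, f N = (N * Z).trace := by
    intro N
    conv_lhs => rw [matrix_eq_sum_single N]
    simp only [map_sum, trace, diag, mul_apply, hZ, of_apply]
    refine Finset.sum_congr rfl fun i _ => Finset.sum_congr rfl fun j _ => ?_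
    rw [← smul_eq_mul, ← map_smul, smul_single, smul_eq_mul, mul_one]
  -- A skew matrix and its negative both lie in the closed cone, so f vanishes on skew matrices.
  have hsymm : Zᵀ = Z := by
    ext i j
    have hK : ∀ s : ℝ, (∀ z : ι → ℝ,
        z ⬝ᵥ (s • (single i j (1 : ℝ) - single j i 1)) *ᵥ z ≤ 0) := by
      intro s z
      rw [smul_mulVec, sub_mulVec, dotProduct_smul, dotProduct_sub]
      have : ∀ a b : ι, z ⬝ᵥ single a b (1 : ℝ) *ᵥ z = z a * z b := by
        intro a b
        simp [single_mulVec, dotProduct, Function.update_apply]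
      rw [this, this, mul_comm, sub_self, smul_zero]
    have h1 := hsq _ (hK 1)
    have h2 := hsq _ (hK (-1))
    rw [map_smul, map_sub, smul_eq_mul] at h1 h2
    simp only [transpose_apply, hZ, of_apply]
    linarith
  refine ⟨Z, ?_, ?_, ?_, fun N hN => by rw [← hfZ, hV N hN]⟩
  · refine PosSemidef.of_dotProduct_mulVec_nonneg (by simpa [IsHermitian] using hsymm) fun x => ?_
    have h1 := hsq (-(vecMulVec x x)) fun z => by
      rw [neg_mulVec, dotProduct_neg, vecMulVec_mulVec, neg_nonpos]
      simp only [op_smul_eq_smul, dotProduct_smul, smul_eq_mul]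
      rw [dotProduct_comm]
      exact mul_self_nonneg _
    rw [map_neg, neg_nonpos, hfZ, trace_mul_comm, mul_vecMulVec, trace_vecMulVec,
      dotProduct_comm] at h1
    simpa using h1
  · intro hZ0
    have h1 := hfD _ hneg1
    rw [hfZ, hZ0, mul_zero, trace_zero] at h1 hM
    linarith
  · rw [← hfZ]
    exact hu.trans hM

open Matrix in
theorem Matrix.conjTranspose_map_ofRealHom {μ ν : Type*} (A : Matrix μ ν ℝ) :
    (A.map Complex.ofRealHom)ᴴ = Aᵀ.map Complex.ofRealHom := by
  ext i j
  simp

open Matrix in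
theorem Matrix.adjoint_toEuclideanLin_map_ofRealHom {μ ν : Type*} [Fintype μ] [DecidableEq μ]
    [Fintype ν] [DecidableEq ν] (A : Matrix μ ν ℝ) :
    LinearMap.adjoint (toEuclideanLin (A.map Complex.ofRealHom))
      = toEuclideanLin (Aᵀ.map Complex.ofRealHom) := by
  rw [← toEuclideanLin_conjTranspose_eq_adjoint, conjTranspose_map_ofRealHom]

open Matrix in
/-- The strict Kalman–Yakubovich–Popov lemma, in the pencil form: a quadratic form `M` that is
negative on all solutions of `Y z = iω X z` and on the kernel of `X` becomes negative
definite after adding `2 (X z)ᵀ P (Y z)` for a suitable symmetric `P`. -/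
theorem Matrix.exists_symm_of_frequency_condition {ι κ : Type*} [Fintype ι] [DecidableEq ι]
    [Fintype κ] [DecidableEq κ] (X Y : Matrix κ ι ℝ) (M : Matrix ι ι ℝ)
    (h : ∀ z : ι → ℂ, z ≠ 0 →
      (X.map Complex.ofReal *ᵥ z = 0 ∨
        ∃ ω : ℝ, Y.map Complex.ofReal *ᵥ z = (Complex.I * ω) • X.map Complex.ofReal *ᵥ z) →
      (star z ⬝ᵥ M.map Complex.ofReal *ᵥ z).re < 0) :
    ∃ P : Matrix κ κ ℝ, Pᵀ = P ∧
      ∀ z : ι → ℝ, z ≠ 0 → 2 * (X *ᵥ z ⬝ᵥ P *ᵥ Y *ᵥ z) + z ⬝ᵥ M *ᵥ z < 0 := by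
  -- Symmetrizing S makes the admissible P-terms the range of a linear map on all matrices.
  let Φ : Matrix κ κ ℝ →ₗ[ℝ] Matrix ι ι ℝ :=
    { toFun := fun S => Xᵀ * (S + Sᵀ) * Y
      map_add' := fun S S' => by
        rw [transpose_add, add_add_add_comm, Matrix.mul_add, Matrix.add_mul]
      map_smul' := fun c S => by
        rw [transpose_smul, ← smul_add, Matrix.mul_smul, Matrix.smul_mul, RingHom.id_apply] }
  by_contra hcon
  obtain ⟨Z, hZ, hZ0, hMZ, hVZ⟩ := exists_posSemidef_trace_of_forall_not_neg M (LinearMap.range Φ)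
    (by
      rintro _ ⟨S, rfl⟩ hneg
      refine hcon ⟨(1 / 2 : ℝ) • (S + Sᵀ), by simp [add_comm], fun z hz => ?_⟩
      have h1 := hneg z hz
      have h2 : z ⬝ᵥ Φ S *ᵥ z = X *ᵥ z ⬝ᵥ (S + Sᵀ) *ᵥ Y *ᵥ z := by
        show z ⬝ᵥ (Xᵀ * (S + Sᵀ) * Y) *ᵥ z = _
        rw [← mulVec_mulVec, ← mulVec_mulVec, dotProduct_mulVec, vecMul_transpose]
      rw [add_mulVec, dotProduct_add, h2] at h1
      rw [smul_mulVec, dotProduct_smul, smul_eq_mul]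
      linarith)
  obtain ⟨B, rfl⟩ : ∃ B : Matrix ι ι ℝ, Z = Bᵀ * B := by
    open scoped MatrixOrder Matrix.Norms.L2Operator in
    simpa [star_eq_conjTranspose] using CStarAlgebra.nonneg_iff_eq_star_mul_self.mp hZ.nonneg
  have hskew : Y * Bᵀ * (X * Bᵀ)ᵀ + X * Bᵀ * (Y * Bᵀ)ᵀ = 0 := by
    rw [Matrix.ext_iff_trace_mul_left]
    intro S
    rw [Matrix.mul_zero, trace_zero, Matrix.mul_add, trace_add]
    have h1 := hVZ (Φ S) ⟨S, rfl⟩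
    have h2 : (Φ S * (Bᵀ * B)).trace = (S * (Y * Bᵀ * (X * Bᵀ)ᵀ)).trace
        + (Sᵀ * (Y * Bᵀ * (X * Bᵀ)ᵀ)).trace := by
      show (Xᵀ * (S + Sᵀ) * Y * (Bᵀ * B)).trace = _
      rw [← trace_add, ← Matrix.add_mul, transpose_mul, transpose_transpose, Matrix.mul_assoc,
        Matrix.mul_assoc, trace_mul_comm]
      simp only [Matrix.mul_assoc]
    have h3 : (Sᵀ * (Y * Bᵀ * (X * Bᵀ)ᵀ)).trace = (S * (X * Bᵀ * (Y * Bᵀ)ᵀ)).trace := by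
      rw [← trace_transpose, transpose_mul, transpose_transpose, trace_mul_comm,
        transpose_mul, transpose_transpose]
    rw [← h3, ← h2, h1]
  set c : ℝ →+* ℂ := Complex.ofRealHom with hc
  obtain ⟨e, he⟩ := LinearMap.exists_orthonormalBasis_of_comp_adjoint_add_eq_zero
    (toEuclideanLin ((X * Bᵀ).map c)) (toEuclideanLin ((Y * Bᵀ).map c)) (by
      rw [adjoint_toEuclideanLin_map_ofRealHom, adjoint_toEuclideanLin_map_ofRealHom,
        ← toLpLin_mul, ← toLpLin_mul, ← map_add,
        ← Matrix.map_mul, ← Matrix.map_mul, ← Matrix.map_add c c.map_add, hskew]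
      simp)
  -- Each z k is zero or subject to the frequency hypothesis, while the values of the form at the z
  -- k sum to tr(MZ) ≥ 0; hence all z k vanish, and so does B.
  set z := fun k => (Bᵀ).map c *ᵥ (e k).ofLp with hz
  have hXz : ∀ (W : Matrix κ ι ℝ) k,
      W.map c *ᵥ z k = (toEuclideanLin ((W * Bᵀ).map c) (e k)).ofLp := by
    intro W k
    rw [hz, toLpLin_apply, Matrix.map_mul, mulVec_mulVec]
  have hform : ∀ k, z k ≠ 0 → (star (z k) ⬝ᵥ M.map c *ᵥ z k).re < 0 := by
    intro k hk
    refine h (z k) hk ?_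
    change X.map c *ᵥ z k = 0 ∨ ∃ ω : ℝ, Y.map c *ᵥ z k = (Complex.I * ω) • X.map c *ᵥ z k
    rw [hXz, hXz]
    rcases he k with h1 | ⟨ω, h1⟩
    · left
      rw [h1]
      rfl
    · right
      exact ⟨ω, by rw [h1]; rfl⟩
  have hsum : ∑ k, (star (z k) ⬝ᵥ M.map c *ᵥ z k).re = (M * (Bᵀ * B)).trace := by
    have h1 : (M * (Bᵀ * B)).trace = (B * M * Bᵀ).trace := by
      rw [← Matrix.mul_assoc, trace_mul_comm, Matrix.mul_assoc]
    have h2 : (((B * M * Bᵀ).trace : ℝ) : ℂ) = ((B * M * Bᵀ).map c).trace := by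
      rw [trace, trace, Complex.ofReal_sum]
      rfl
    have h3 := LinearMap.trace_eq_sum_inner (toEuclideanLin ((B * M * Bᵀ).map c)) e
    have h4 : LinearMap.trace ℂ _ (toEuclideanLin ((B * M * Bᵀ).map c))
        = ((B * M * Bᵀ).map c).trace :=
      (congrArg (LinearMap.trace ℂ _) (LinearEquiv.congr_fun (toLpLin_eq_toLin 2 2) _)).trans
        (trace_toLin_eq _ _)
    rw [h4, ← h2] at h3
    rw [h1, ← Complex.ofReal_re (B * M * Bᵀ).trace, h3, Complex.re_sum]
    refine Finset.sum_congr rfl fun k _ => ?_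
    rw [EuclideanSpace.inner_eq_star_dotProduct, toLpLin_apply]
    congr 1
    refine Eq.trans ?_ (dotProduct_comm _ _)
    show star ((Bᵀ).map c *ᵥ (e k).ofLp) ⬝ᵥ M.map c *ᵥ (Bᵀ).map c *ᵥ (e k).ofLp
      = star (e k).ofLp ⬝ᵥ (B * M * Bᵀ).map c *ᵥ (e k).ofLp
    rw [star_mulVec, conjTranspose_map_ofRealHom, transpose_transpose, ← dotProduct_mulVec, mulVec_mulVec, mulVec_mulVec,
      Matrix.map_mul, Matrix.map_mul, Matrix.mul_assoc]
  have hz0 : ∀ k, z k = 0 := by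
    by_contra hne
    push Not at hne
    obtain ⟨k, hk⟩ := hne
    have : ∑ k, (star (z k) ⬝ᵥ M.map c *ᵥ z k).re < 
        ∑ _k : Fin (Module.finrank ℂ (EuclideanSpace ℂ ι)), (0 : ℝ) := by
      refine Finset.sum_lt_sum (fun j _ => ?_) ⟨k, Finset.mem_univ _, hform k hk⟩
      by_cases hj : z j = 0
      · simp [hj]
      · exact (hform j hj).le
    rw [hsum, Finset.sum_const_zero] at this
    linarith
  have hB : toEuclideanLin ((Bᵀ).map c) = 0 := by
    refine e.toBasis.ext fun k => ?_
    rw [OrthonormalBasis.coe_toBasis, toLpLin_apply, LinearMap.zero_apply]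
    exact congrArg (WithLp.toLp 2) (hz0 k)
  have hB' : (Bᵀ).map c = 0 := by simpa using hB
  apply hZ0
  have : Bᵀ = 0 := by
    ext i j
    have := congrFun (congrFun hB' i) j
    simpa [hc] using this
  rw [this, Matrix.zero_mul]

/-! ### Lyapunov inequalities, complex eigenvalues and instability -/

open Matrix in
theorem Matrix.hasEigenvalue_toLin'_iff {K ι : Type*} [Field K] [Fintype ι] [DecidableEq ι]
    (A : Matrix ι ι K) (μ : K) :
    Module.End.HasEigenvalue (toLin' A) μ ↔ ∃ v : ι → K, v ≠ 0 ∧ A *ᵥ v = μ • v := by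
  constructor
  · intro h
    obtain ⟨v, hv⟩ := h.exists_hasEigenvector
    exact ⟨v, hv.2, by simpa using hv.apply_eq_smul⟩
  · rintro ⟨v, hv, h⟩
    exact Module.End.hasEigenvalue_of_hasEigenvector
      ⟨Module.End.mem_eigenspace_iff.mpr (by simpa using h), hv⟩

open Matrix in
theorem isComplexEigenvalue_iff {n : ℕ} (A : Matrix (Fin n) (Fin n) ℝ) (μ : ℂ) :
    IsComplexEigenvalue A μ ↔ ∃ v : Fin n → ℂ, v ≠ 0 ∧ toComplexMatrix A *ᵥ v = μ • v :=
  hasEigenvalue_toLin'_iff _ _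

open Matrix in
/-- The real part of the sesquilinear form of a real matrix, in real and imaginary parts. -/
theorem re_star_dotProduct_toComplexMatrix_mulVec {n : ℕ} (A : Matrix (Fin n) (Fin n) ℝ)
    (u v : Fin n → ℂ) :
    (star u ⬝ᵥ toComplexMatrix A *ᵥ v).re
      = (fun i => (u i).re) ⬝ᵥ A *ᵥ (fun i => (v i).re)
        + (fun i => (u i).im) ⬝ᵥ A *ᵥ (fun i => (v i).im) := by
  simp only [dotProduct, mulVec, toComplexMatrix, Complex.re_sum, Complex.im_sum, Complex.mul_re,
    Complex.mul_im, Pi.star_apply, map_apply, Complex.star_def, Complex.conj_re, Complex.conj_im,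
    Complex.ofReal_re, Complex.ofReal_im, ← Finset.sum_add_distrib]
  refine Finset.sum_congr rfl fun i _ => ?_
  simp

open Matrix in
theorem re_star_dotProduct_toComplexMatrix_mulVec_comm {n : ℕ} {P : Matrix (Fin n) (Fin n) ℝ}
    (hP : Pᵀ = P) (u v : Fin n → ℂ) :
    (star u ⬝ᵥ toComplexMatrix P *ᵥ v).re = (star v ⬝ᵥ toComplexMatrix P *ᵥ u).re := by
  have h : ∀ x y : Fin n → ℝ, x ⬝ᵥ P *ᵥ y = y ⬝ᵥ P *ᵥ x := fun x y => by
    rw [dotProduct_mulVec, ← mulVec_transpose, hP, dotProduct_comm]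
  simp only [re_star_dotProduct_toComplexMatrix_mulVec, h (fun i => (u i).re),
    h (fun i => (u i).im)]

theorem toComplexMatrix_mul {n : ℕ} (A B : Matrix (Fin n) (Fin n) ℝ) :
    toComplexMatrix (A * B) = toComplexMatrix A * toComplexMatrix B :=
  Matrix.map_mul (f := Complex.ofRealHom)

open Matrix in
theorem isNegDef_lyapunov_iff {n : ℕ} {P : Matrix (Fin n) (Fin n) ℝ} (hP : Pᵀ = P)
    (A : Matrix (Fin n) (Fin n) ℝ) :
    IsNegDef (P * A + Aᵀ * P) ↔ ∀ x : Fin n → ℝ, x ≠ 0 → x ⬝ᵥ P *ᵥ A *ᵥ x < 0 := by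
  have key : ∀ x : Fin n → ℝ, star x ⬝ᵥ (-(P * A + Aᵀ * P)) *ᵥ x = -(2 * (x ⬝ᵥ P *ᵥ A *ᵥ x)) := by
    intro x
    have : x ⬝ᵥ Aᵀ *ᵥ P *ᵥ x = x ⬝ᵥ P *ᵥ A *ᵥ x := by
      rw [dotProduct_mulVec x Aᵀ, vecMul_transpose, dotProduct_mulVec, ← mulVec_transpose, hP,
        dotProduct_comm]
    rw [neg_mulVec, dotProduct_neg, add_mulVec, dotProduct_add, ← mulVec_mulVec, ← mulVec_mulVec,
      star_trivial, this]
    ring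
  constructor
  · intro h x hx
    have := h.dotProduct_mulVec_pos hx
    rw [key] at this
    linarith
  · intro h
    refine PosDef.of_dotProduct_mulVec_pos ?_ fun x hx => ?_
    · rw [IsHermitian, conjTranspose_eq_transpose_of_trivial]
      simp [hP, add_comm]
    · rw [key]
      linarith [h x hx]

open Matrix in
theorem re_star_dotProduct_lyapunov_neg {n : ℕ} {P A : Matrix (Fin n) (Fin n) ℝ}
    (h : ∀ x : Fin n → ℝ, x ≠ 0 → x ⬝ᵥ P *ᵥ A *ᵥ x < 0) {v : Fin n → ℂ} (hv : v ≠ 0) :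
    (star v ⬝ᵥ toComplexMatrix P *ᵥ toComplexMatrix A *ᵥ v).re < 0 := by
  rw [mulVec_mulVec, ← toComplexMatrix_mul, re_star_dotProduct_toComplexMatrix_mulVec,
    ← mulVec_mulVec, ← mulVec_mulVec]
  have hle : ∀ x : Fin n → ℝ, x ⬝ᵥ P *ᵥ A *ᵥ x ≤ 0 := fun x => by
    by_cases hx : x = 0
    · simp [hx]
    · exact (h x hx).le
  by_cases hre : (fun i => (v i).re) = 0
  · have him : (fun i => (v i).im) ≠ 0 := fun him =>
      hv (funext fun i => Complex.ext (congrFun hre i) (congrFun him i))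
    linarith [hle fun i => (v i).re, h _ him]
  · linarith [hle fun i => (v i).im, h _ hre]

open Matrix Filter in
/-- The powers of a complex matrix whose eigenvalues lie in the open unit disc tend to zero. -/
theorem Matrix.tendsto_pow_mulVec_of_forall_norm_lt_one {n : ℕ} (B : Matrix (Fin n) (Fin n) ℂ)
    (hB : ∀ (β : ℂ) (v : Fin n → ℂ), v ≠ 0 → B *ᵥ v = β • v → ‖β‖ < 1) (v : Fin n → ℂ) :
    Tendsto (fun k : ℕ => (B ^ k) *ᵥ v) atTop (nhds 0) := by
  open scoped Matrix.Norms.Operator in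
  rcases isEmpty_or_nonempty (Fin n) with hn | hn
  · simp [Subsingleton.elim _ (0 : Fin n → ℂ)]
  have hr : spectralRadius ℂ B < 1 := by
    refine spectrum.spectralRadius_lt_of_forall_lt_of_nonempty (r := 1)
      (spectrum.nonempty B) fun β hβ => ?_
    rw [← Matrix.spectrum_toLin', ← Module.End.hasEigenvalue_iff_mem_spectrum,
      hasEigenvalue_toLin'_iff] at hβ
    obtain ⟨w, hw, h⟩ := hβ
    exact hB β w hw h
  have hpow : Tendsto (fun k : ℕ => B ^ k) atTop (nhds 0) := by
    -- With r strictly between the spectral radius and 1, Gelfand's formula gives ‖B ^ k‖ < r ^ k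
    -- eventually.
    obtain ⟨r, hr1, hr2⟩ := ENNReal.lt_iff_exists_nnreal_btwn.mp hr
    have h1 := spectrum.pow_nnnorm_pow_one_div_tendsto_nhds_spectralRadius B
    have h2 := h1.eventually_lt_const hr1
    have hr3 : (r : ℝ) < 1 := by exact_mod_cast hr2
    refine squeeze_zero_norm' ?_ (tendsto_pow_atTop_nhds_zero_of_lt_one r.2 hr3)
    filter_upwards [h2, eventually_gt_atTop 0] with k hk hk0
    have hk' : (0 : ℝ) < k := by exact_mod_cast hk0
    have h3 := ENNReal.rpow_lt_rpow hk hk'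
    rw [← ENNReal.rpow_mul, one_div, inv_mul_cancel₀ hk'.ne', ENNReal.rpow_one,
      ENNReal.rpow_natCast] at h3
    have h4 : ‖B ^ k‖₊ < r ^ k := by exact_mod_cast h3
    exact_mod_cast h4.le
  have hcont : Continuous fun C : Matrix (Fin n) (Fin n) ℂ => C *ᵥ v := by fun_prop
  rw [← zero_mulVec v]
  exact (hcont.tendsto 0).comp hpow

open Matrix in
theorem re_star_dotProduct_mulVec_smul {n : ℕ} {P : Matrix (Fin n) (Fin n) ℝ} (hP : Pᵀ = P)
    (v : Fin n → ℂ) (μ : ℂ) :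
    (star v ⬝ᵥ toComplexMatrix P *ᵥ (μ • v)).re
      = μ.re * (star v ⬝ᵥ toComplexMatrix P *ᵥ v).re := by
  -- Symmetry tested on the pair v, iv says that v*Pv is real, so only Re μ survives.
  have him := re_star_dotProduct_toComplexMatrix_mulVec_comm hP v (Complex.I • v)
  simp only [mulVec_smul, dotProduct_smul, star_smul, smul_dotProduct, smul_eq_mul, Complex.mul_re,
    Complex.star_def, Complex.conj_I, Complex.I_re, Complex.I_im, Complex.neg_re,
    Complex.neg_im] at him ⊢
  have : (star v ⬝ᵥ toComplexMatrix P *ᵥ v).im = 0 := by linarith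
  rw [this]
  ring

open Matrix Filter in
/-- A real matrix with a strict Lyapunov inequality for an indefinite `P` is unstable. The Cayley
transform of a stable `A` would have powers tending to zero while decreasing the form of `P`. -/
theorem IsUnstable.of_lyapunov {n : ℕ} {P A : Matrix (Fin n) (Fin n) ℝ} (hP : Pᵀ = P)
    (hA : ∀ x : Fin n → ℝ, x ≠ 0 → x ⬝ᵥ P *ᵥ A *ᵥ x < 0) {v : Fin n → ℂ}
    (hv : (star v ⬝ᵥ toComplexMatrix P *ᵥ v).re < 0) : IsUnstable A := by
  by_contra hstab
  have hneg : ∀ (μ : ℂ) (w : Fin n → ℂ), w ≠ 0 → toComplexMatrix A *ᵥ w = μ • w → μ.re < 0 := by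
    intro μ w hw h
    rcases lt_trichotomy μ.re 0 with h0 | h0 | h0
    · exact h0
    · have h1 := re_star_dotProduct_lyapunov_neg hA hw
      rw [h, re_star_dotProduct_mulVec_smul hP, h0, zero_mul] at h1
      exact absurd h1 (lt_irrefl _)
    · exact absurd ⟨μ, (isComplexEigenvalue_iff A μ).mpr ⟨w, hw, h⟩, h0⟩ hstab
  set C := toComplexMatrix A - 1 with hC
  have hCunit : IsUnit C := by
    rw [← mulVec_injective_iff_isUnit]
    intro x y hxy
    by_contra hne
    have h1 : C *ᵥ (x - y) = 0 := by
      rw [mulVec_sub]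
      exact sub_eq_zero.mpr hxy
    rw [hC, sub_mulVec, one_mulVec, sub_eq_zero] at h1
    have h2 := hneg 1 (x - y) (sub_ne_zero.mpr hne) (by rw [h1, one_smul])
    norm_num at h2
  have hCinv : ∀ w, C *ᵥ C⁻¹ *ᵥ w = w := fun w => by
    rw [mulVec_mulVec, mul_nonsing_inv _ ((isUnit_iff_isUnit_det C).mp hCunit), one_mulVec]
  set B := (toComplexMatrix A + 1) * C⁻¹ with hB
  have hBw : ∀ w, B *ᵥ w = toComplexMatrix A *ᵥ C⁻¹ *ᵥ w + C⁻¹ *ᵥ w := fun w => by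
    rw [hB, ← mulVec_mulVec, add_mulVec, one_mulVec]
  have hw' : ∀ w, w = toComplexMatrix A *ᵥ C⁻¹ *ᵥ w - C⁻¹ *ᵥ w := fun w => by
    conv_lhs => rw [← hCinv w, hC, sub_mulVec, one_mulVec]
  have hBnorm : ∀ (β : ℂ) (w : Fin n → ℂ), w ≠ 0 → B *ᵥ w = β • w → ‖β‖ < 1 := by
    intro β w hw h
    have h1 := hw' w
    rw [hBw] at h
    have hy : C⁻¹ *ᵥ w ≠ 0 := fun hy => hw (by rw [← hCinv w, hy, mulVec_zero])
    set y := C⁻¹ *ᵥ w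
    have h2 : (β - 1) • toComplexMatrix A *ᵥ y = (β + 1) • y := by
      rw [h1, smul_sub] at h
      rw [sub_smul, add_smul, one_smul, one_smul, sub_eq_iff_eq_add, add_assoc,
        add_comm y, h]
      abel
    have hβ : β - 1 ≠ 0 := by
      intro hβ
      rw [hβ, zero_smul, eq_comm, smul_eq_zero, sub_eq_zero.mp hβ] at h2
      exact hy (h2.resolve_left (by norm_num))
    -- Re ((β + 1)/(β - 1)) has the sign of |β|² - 1.
    have h3 := hneg ((β + 1) / (β - 1)) y hy (by
      rw [div_eq_inv_mul, mul_smul, ← h2, smul_smul, inv_mul_cancel₀ hβ, one_smul])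
    rw [Complex.div_re, ← add_div, div_neg_iff] at h3
    have h4 := Complex.normSq_pos.mpr hβ
    have h5 := (h3.resolve_left (fun h => by linarith [h.2])).1
    simp only [Complex.add_re, Complex.sub_re, Complex.add_im, Complex.sub_im, Complex.one_re,
      Complex.one_im] at h5
    have h6 : ‖β‖ ^ 2 < 1 := by
      rw [← Complex.normSq_eq_norm_sq, Complex.normSq_apply]
      linarith
    exact (sq_lt_one_iff₀ (norm_nonneg _)).mp h6
  -- With w = Ay - y and Bw = Ay + y, the difference of the two forms is 4 Re(y*PAy) ≤ 0.
  have hdecr : ∀ w, (star (B *ᵥ w) ⬝ᵥ toComplexMatrix P *ᵥ B *ᵥ w).re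
      ≤ (star w ⬝ᵥ toComplexMatrix P *ᵥ w).re := by
    intro w
    rw [hBw]
    conv_rhs => rw [hw' w]
    set y := C⁻¹ *ᵥ w
    have h1 : (star y ⬝ᵥ toComplexMatrix P *ᵥ toComplexMatrix A *ᵥ y).re ≤ 0 := by
      by_cases hy : y = 0
      · simp [hy]
      · exact (re_star_dotProduct_lyapunov_neg hA hy).le
    have h2 := re_star_dotProduct_toComplexMatrix_mulVec_comm hP (toComplexMatrix A *ᵥ y) y
    simp only [star_add, star_sub, mulVec_add, mulVec_sub, dotProduct_add, dotProduct_sub,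
      add_dotProduct, sub_dotProduct, Complex.add_re, Complex.sub_re]
    linarith
  have hpow : ∀ k : ℕ, (star ((B ^ k) *ᵥ v) ⬝ᵥ toComplexMatrix P *ᵥ (B ^ k) *ᵥ v).re
      ≤ (star v ⬝ᵥ toComplexMatrix P *ᵥ v).re := by
    intro k
    induction k with
    | zero => simp
    | succ k ih =>
      rw [pow_succ', ← mulVec_mulVec]
      exact (hdecr _).trans ih
  have hlim := tendsto_pow_mulVec_of_forall_norm_lt_one B hBnorm v
  have hcont : Continuous fun w : Fin n → ℂ => (star w ⬝ᵥ toComplexMatrix P *ᵥ w).re := by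
    fun_prop
  have h1 := (hcont.tendsto 0).comp hlim
  have h2 := le_of_tendsto h1 (Eventually.of_forall hpow)
  simp only [mulVec_zero, dotProduct_zero, Complex.zero_re] at h2
  linarith

-- An eigenvector v for μ works: Re μ · v*Pv = Re(v*PAv) < 0 with Re μ > 0.
open Matrix in
theorem IsUnstable.exists_re_form_neg {n : ℕ} {P A : Matrix (Fin n) (Fin n) ℝ} (hP : Pᵀ = P)
    (hA : ∀ x : Fin n → ℝ, x ≠ 0 → x ⬝ᵥ P *ᵥ A *ᵥ x < 0) (h : IsUnstable A) :
    ∃ v : Fin n → ℂ, (star v ⬝ᵥ toComplexMatrix P *ᵥ v).re < 0 := by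
  obtain ⟨μ, hμ, hre⟩ := h
  obtain ⟨v, hv, hAv⟩ := (isComplexEigenvalue_iff A μ).mp hμ
  have h1 := re_star_dotProduct_lyapunov_neg hA hv
  rw [hAv, re_star_dotProduct_mulVec_smul hP] at h1
  exact ⟨v, by nlinarith⟩

open Matrix in
theorem HasCommonLyapunovMatrix.isUnstable_convexCombination {n : ℕ}
    {A₁ A₂ : Matrix (Fin n) (Fin n) ℝ} (h : HasCommonLyapunovMatrix A₁ A₂) (h₁ : IsUnstable A₁)
    {s t : ℝ} (hs : 0 < s) (ht : 0 < t) : IsUnstable (s • A₁ + t • A₂) := by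
  obtain ⟨P, hP, hA₁, hA₂⟩ := h
  have hP := hP.symm
  rw [isNegDef_lyapunov_iff hP] at hA₁ hA₂
  obtain ⟨v, hv⟩ := h₁.exists_re_form_neg hP hA₁
  refine IsUnstable.of_lyapunov hP (fun x hx => ?_) hv
  rw [add_mulVec, smul_mulVec, smul_mulVec, mulVec_add, mulVec_smul, mulVec_smul, dotProduct_add,
    dotProduct_smul, dotProduct_smul, smul_eq_mul, smul_eq_mul]
  nlinarith [mul_neg_of_pos_of_neg hs (hA₁ x hx), mul_neg_of_pos_of_neg ht (hA₂ x hx)]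

open Matrix in
theorem HasCommonLyapunovMatrix.noNegativeRealEigenvalue_mul {n : ℕ}
    {A₁ A₂ : Matrix (Fin n) (Fin n) ℝ} (h : HasCommonLyapunovMatrix A₁ A₂) :
    NoNegativeRealEigenvalue (A₁ * A₂) := by
  obtain ⟨P, hP, hA₁, hA₂⟩ := h
  have hP := hP.symm
  rw [isNegDef_lyapunov_iff hP] at hA₁ hA₂
  intro r hr hev
  obtain ⟨x, hx, hAx⟩ := (hasEigenvalue_toLin'_iff _ _).mp hev
  rw [← mulVec_mulVec] at hAx
  have h2 := hA₂ x hx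
  have hy : A₂ *ᵥ x ≠ 0 := fun hy => by simp [hy] at h2
  have h1 := hA₁ _ hy
  rw [hAx, mulVec_smul, dotProduct_smul, smul_eq_mul, dotProduct_mulVec, ← mulVec_transpose, hP,
    dotProduct_comm] at h1
  nlinarith

/-! ### From the frequency condition to a common Lyapunov matrix -/

open Matrix in
theorem NoImaginaryEigenvalue.isUnit {n : ℕ} {A : Matrix (Fin n) (Fin n) ℝ}
    (hA : NoImaginaryEigenvalue A) (ω : ℝ) :
    IsUnit ((Complex.I * (ω : ℂ)) • (1 : Matrix (Fin n) (Fin n) ℂ) - toComplexMatrix A) := by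
  rw [← mulVec_injective_iff_isUnit]
  intro x y hxy
  by_contra hne
  have h1 : ((Complex.I * (ω : ℂ)) • (1 : Matrix (Fin n) (Fin n) ℂ) - toComplexMatrix A) *ᵥ (x - y)
      = 0 := by
    rw [mulVec_sub]
    exact sub_eq_zero.mpr hxy
  rw [sub_mulVec, smul_mulVec, one_mulVec, sub_eq_zero] at h1
  exact hA (Complex.I * ω)
    ((isComplexEigenvalue_iff A _).mpr ⟨x - y, sub_ne_zero.mpr hne, h1.symm⟩) (by simp)

open Matrix in
/-- The strict positive-real condition provides a common Lyapunov matrix. -/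
theorem hasCommonLyapunovMatrix_of_frequency_condition {n : ℕ} {A : Matrix (Fin n) (Fin n) ℝ}
    (b c : Fin n → ℝ) (δ : ℝ) (hA : NoImaginaryEigenvalue A)
    (h : ∀ ω : ℝ, 0 < 1 - ((δ : ℂ) * transferFunction A b c (Complex.I * (ω : ℂ))).re) :
    HasCommonLyapunovMatrix A (A + δ • vecMulVec b c) := by
  -- With z = (x, u), the pencil Yz = iωXz is the system iωx = Ax + bu, and M is the form u(δcx -
  -- u), which vanishes at u = 0 and at u = δcx: the two feedbacks producing A and A + δbc.
  obtain ⟨P, hP, hneg⟩ := exists_symm_of_frequency_condition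
    (fromCols (1 : Matrix (Fin n) (Fin n) ℝ) (0 : Matrix (Fin n) Unit ℝ))
    (fromCols A (of fun i _ => b i))
    (fromBlocks 0 0 (of fun _ j => δ * c j) (-1 : Matrix Unit Unit ℝ)) (by
      intro z hz hdyn
      set x : Fin n → ℂ := fun i => z (Sum.inl i) with hx
      set u : ℂ := z (Sum.inr ()) with hu
      have hX : (fromCols (1 : Matrix (Fin n) (Fin n) ℝ) (0 : Matrix (Fin n) Unit ℝ)).map
          Complex.ofReal *ᵥ z = x := by
        ext i
        simp [mulVec, dotProduct, one_apply, hx, apply_ite Complex.ofReal]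
      have hY : (fromCols A (of fun i (_ : Unit) => b i)).map Complex.ofReal *ᵥ z
          = toComplexMatrix A *ᵥ x + u • fun i => (b i : ℂ) := by
        ext i
        simp [mulVec, dotProduct, hx, hu, toComplexMatrix, mul_comm]
      have hM : star z ⬝ᵥ (fromBlocks (0 : Matrix (Fin n) (Fin n) ℝ) 0
            (of fun (_ : Unit) j => δ * c j) (-1 : Matrix Unit Unit ℝ)).map Complex.ofReal *ᵥ z
          = star u * ((δ : ℂ) * ((fun i => (c i : ℂ)) ⬝ᵥ x)) - star u * u := by
        simp [mulVec, dotProduct, hx, hu, Finset.mul_sum, mul_add, mul_assoc, sub_eq_add_neg]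
      rw [hM]
      rw [hX, hY] at hdyn
      have huu : (star u * u).re = Complex.normSq u := by
        rw [Complex.star_def, ← Complex.normSq_eq_conj_mul_self, Complex.ofReal_re]
      have hz' : x = 0 → u ≠ 0 := by
        intro hx0 hu0
        apply hz
        ext i
        rcases i with i | i
        · exact congrFun hx0 i
        · exact hu0
      rcases hdyn with hx0 | ⟨ω, hω⟩
      · rw [hx0, dotProduct_zero, mul_zero, mul_zero, zero_sub, Complex.neg_re, huu, neg_lt_zero]
        exact Complex.normSq_pos.mpr (hz' hx0)
      · set R := (Complex.I * (ω : ℂ)) • (1 : Matrix (Fin n) (Fin n) ℂ) - toComplexMatrix A with hR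
        have hRx : R *ᵥ x = u • fun i => (b i : ℂ) := by
          rw [hR, sub_mulVec, smul_mulVec, one_mulVec, ← hω]
          abel
        have hxR : x = u • R⁻¹ *ᵥ fun i => (b i : ℂ) := by
          rw [← mulVec_smul, ← hRx, mulVec_mulVec,
            nonsing_inv_mul _ ((isUnit_iff_isUnit_det _).mp (hA.isUnit ω)), one_mulVec]
        have hu0 : u ≠ 0 := by
          intro hu0
          exact hz' (by rw [hxR, hu0, zero_smul]) hu0
        have hcx : (fun i => (c i : ℂ)) ⬝ᵥ x
            = u * transferFunction A b c (Complex.I * (ω : ℂ)) := by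
          rw [hxR, dotProduct_smul, smul_eq_mul]
          rfl
        have hpos := Complex.normSq_pos.mpr hu0
        -- On a solution the form is |u|² (δ c(iω - A)⁻¹b - 1), so its real part is negative exactly
        -- by the hypothesis.
        have h1 : star u * ((δ : ℂ) * ((fun i => (c i : ℂ)) ⬝ᵥ x))
            = (Complex.normSq u : ℂ) * ((δ : ℂ) * transferFunction A b c (Complex.I * (ω : ℂ))) := by
          rw [hcx, Complex.normSq_eq_conj_mul_self, Complex.star_def]
          ring
        rw [h1, Complex.sub_re, huu, Complex.re_ofReal_mul]
        nlinarith [mul_pos hpos (h ω)])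
  have hquad : ∀ (x : Fin n → ℝ) (u : ℝ), x ≠ 0 →
      2 * (x ⬝ᵥ P *ᵥ (A *ᵥ x + u • b)) + (u * (δ * (c ⬝ᵥ x)) - u * u) < 0 := by
    intro x u hx
    have h1 := hneg (Sum.elim x fun _ => u) fun h0 => hx (funext fun i => congrFun h0 (Sum.inl i))
    have hX : fromCols (1 : Matrix (Fin n) (Fin n) ℝ) (0 : Matrix (Fin n) Unit ℝ)
        *ᵥ Sum.elim x (fun _ => u) = x := by
      simp
    have hY : fromCols A (of fun i (_ : Unit) => b i) *ᵥ Sum.elim x (fun _ => u)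
        = A *ᵥ x + u • b := by
      ext i
      simp [mulVec, dotProduct, mul_comm]
    have hM : Sum.elim x (fun _ => u) ⬝ᵥ (fromBlocks (0 : Matrix (Fin n) (Fin n) ℝ) 0
          (of fun (_ : Unit) j => δ * c j) (-1 : Matrix Unit Unit ℝ)) *ᵥ Sum.elim x (fun _ => u)
        = u * (δ * (c ⬝ᵥ x)) - u * u := by
      simp [mulVec, dotProduct, Finset.mul_sum, mul_add, mul_assoc, sub_eq_add_neg]
    rwa [hX, hY, hM] at h1
  refine ⟨P, hP.symm, (isNegDef_lyapunov_iff hP _).mpr fun x hx => ?_,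
    (isNegDef_lyapunov_iff hP _).mpr fun x hx => ?_⟩
  · have h1 := hquad x 0 hx
    rw [zero_smul, add_zero] at h1
    linarith
  · have h1 := hquad x (δ * (c ⬝ᵥ x)) hx
    have h2 : (A + δ • vecMulVec b c) *ᵥ x = A *ᵥ x + (δ * (c ⬝ᵥ x)) • b := by
      rw [add_mulVec, smul_mulVec, vecMulVec_mulVec, op_smul_eq_smul, smul_smul]
    rw [h2]
    linarith

/-! ### From the spectrum of the product to the frequency condition -/

open Matrix in
theorem toComplexMatrix_mulVec_re {n : ℕ} (A : Matrix (Fin n) (Fin n) ℝ) (v : Fin n → ℂ)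
    (i : Fin n) : ((toComplexMatrix A *ᵥ v) i).re = (A *ᵥ fun j => (v j).re) i := by
  simp [mulVec, dotProduct, toComplexMatrix, Complex.re_sum]

open Matrix in
theorem toComplexMatrix_mulVec_im {n : ℕ} (A : Matrix (Fin n) (Fin n) ℝ) (v : Fin n → ℂ)
    (i : Fin n) : ((toComplexMatrix A *ᵥ v) i).im = (A *ᵥ fun j => (v j).im) i := by
  simp [mulVec, dotProduct, toComplexMatrix, Complex.im_sum]

open Matrix Filter Bornology in
theorem NoImaginaryEigenvalue.continuous_transferFunction {n : ℕ} {A : Matrix (Fin n) (Fin n) ℝ}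
    (hA : NoImaginaryEigenvalue A) (b c : Fin n → ℝ) :
    Continuous fun ω : ℝ => transferFunction A b c (Complex.I * (ω : ℂ)) := by
  open scoped Matrix.Norms.Operator in
  have hinv : Continuous fun ω : ℝ =>
      ((Complex.I * (ω : ℂ)) • (1 : Matrix (Fin n) (Fin n) ℂ) - toComplexMatrix A)⁻¹ := by
    rw [continuous_iff_continuousAt]
    intro ω
    simp only [nonsing_inv_eq_ringInverse]
    have h1 := NormedRing.inverse_continuousAt (hA.isUnit ω).unit
    have h2 : Continuous fun ω : ℝ =>
        (Complex.I * (ω : ℂ)) • (1 : Matrix (Fin n) (Fin n) ℂ) - toComplexMatrix A := by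
      fun_prop
    exact ContinuousAt.comp (f := fun ω : ℝ =>
      (Complex.I * (ω : ℂ)) • (1 : Matrix (Fin n) (Fin n) ℂ) - toComplexMatrix A) h1 h2.continuousAt
  unfold transferFunction
  fun_prop

open Matrix Filter Bornology in
theorem tendsto_transferFunction_atTop {n : ℕ} (A : Matrix (Fin n) (Fin n) ℝ)
    (b c : Fin n → ℝ) :
    Tendsto (fun ω : ℝ => transferFunction A b c (Complex.I * (ω : ℂ))) atTop (nhds 0) := by
  open scoped Matrix.Norms.Operator in
  have h1 : Tendsto (fun ω : ℝ => Complex.I * (ω : ℂ)) atTop (cobounded ℂ) := by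
    rw [← tendsto_norm_atTop_iff_cobounded]
    simpa using tendsto_abs_atTop_atTop
  have h2 := (spectrum.resolvent_tendsto_cobounded (𝕜 := ℂ) (toComplexMatrix A)).comp h1
  have h3 : Continuous fun R : Matrix (Fin n) (Fin n) ℂ =>
      (fun i => (c i : ℂ)) ⬝ᵥ R *ᵥ (fun i => (b i : ℂ)) := by fun_prop
  have h4 := (h3.tendsto 0).comp h2
  rw [zero_mulVec, dotProduct_zero] at h4
  refine h4.congr fun ω => ?_
  simp only [Function.comp_apply, resolvent, transferFunction, nonsing_inv_eq_ringInverse,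
    Algebra.algebraMap_eq_smul_one]

open Matrix Filter in
/-- If `A (A + δ b c)` has no negative eigenvalue, the strict positive-real condition holds: at a
zero of the frequency function, the real part of `(iω - A)⁻¹ b` is an eigenvector for `-ω²`. -/
theorem frequency_condition_of_noNegativeRealEigenvalue {n : ℕ} {A : Matrix (Fin n) (Fin n) ℝ}
    (b c : Fin n → ℝ) (δ : ℝ) (hA : NoImaginaryEigenvalue A)
    (hA' : NoImaginaryEigenvalue (A + δ • vecMulVec b c))
    (h : NoNegativeRealEigenvalue (A * (A + δ • vecMulVec b c))) (ω : ℝ) :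
    0 < 1 - ((δ : ℂ) * transferFunction A b c (Complex.I * (ω : ℂ))).re := by
  set g : ℝ → ℝ := fun ω => 1 - ((δ : ℂ) * transferFunction A b c (Complex.I * (ω : ℂ))).re with hg
  by_contra hcon
  have hgc : Continuous g := by
    have := hA.continuous_transferFunction b c
    fun_prop
  have hlim : Tendsto g atTop (nhds 1) := by
    have h1 : Continuous fun z : ℂ => 1 - ((δ : ℂ) * z).re := by fun_prop
    have h2 := (h1.tendsto 0).comp (tendsto_transferFunction_atTop A b c)
    rw [mul_zero, Complex.zero_re, sub_zero] at h2
    exact h2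
  -- g is positive at some ω₁ and nonpositive at ω, so it has a zero ν.
  obtain ⟨ω₁, hω₁⟩ := (hlim.eventually_const_lt one_pos).exists
  obtain ⟨ν, hν⟩ := mem_range_of_exists_le_of_exists_ge hgc ⟨ω, not_lt.mp hcon⟩ ⟨ω₁, hω₁.le⟩
  set R := (Complex.I * (ν : ℂ)) • (1 : Matrix (Fin n) (Fin n) ℂ) - toComplexMatrix A with hR
  set r := R⁻¹ *ᵥ fun i => (b i : ℂ) with hr
  set p : Fin n → ℝ := fun i => (r i).re with hp
  set q : Fin n → ℝ := fun i => (r i).im with hq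
  have hRr : R *ᵥ r = fun i => (b i : ℂ) := by
    rw [hr, mulVec_mulVec, mul_nonsing_inv _ ((isUnit_iff_isUnit_det _).mp (hA.isUnit ν)),
      one_mulVec]
  rw [hR, sub_mulVec, smul_mulVec, one_mulVec] at hRr
  have hre : A *ᵥ p + b = -ν • q := by
    ext i
    have h1 := congrArg Complex.re (congrFun hRr i)
    simp only [Pi.sub_apply, Complex.sub_re, toComplexMatrix_mulVec_re] at h1
    simp at h1
    simp only [Pi.add_apply, Pi.smul_apply, smul_eq_mul, hq, hp]
    linarith
  have him : A *ᵥ q = ν • p := by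
    ext i
    have h1 := congrArg Complex.im (congrFun hRr i)
    simp only [Pi.sub_apply, Complex.sub_im, toComplexMatrix_mulVec_im] at h1
    simp at h1
    simp only [Pi.smul_apply, smul_eq_mul, hq, hp]
    linarith
  have hcp : δ * (c ⬝ᵥ p) = 1 := by
    have h1 : (transferFunction A b c (Complex.I * (ν : ℂ))).re = c ⬝ᵥ p := by
      show ((fun i => (c i : ℂ)) ⬝ᵥ r).re = _
      simp [dotProduct, Complex.re_sum, hp]
    have h2 : g ν = 1 - δ * (c ⬝ᵥ p) := by
      rw [← h1, ← Complex.re_ofReal_mul]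
    linarith
  have hp0 : p ≠ 0 := by
    intro h0
    rw [h0, dotProduct_zero, mul_zero] at hcp
    exact zero_ne_one hcp
  -- The zero of g means δ c·p = 1, so the rank-one term contributes exactly b.
  have hA'p : (A + δ • vecMulVec b c) *ᵥ p = -ν • q := by
    rw [add_mulVec, smul_mulVec, vecMulVec_mulVec, op_smul_eq_smul, smul_smul, hcp, one_smul, hre]
  by_cases hν0 : ν = 0
  · rw [hν0, neg_zero, zero_smul] at hA'p
    refine hA' 0 ((isComplexEigenvalue_iff _ _).mpr ⟨fun i => (p i : ℂ), ?_, ?_⟩) rfl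
    · intro h0
      exact hp0 (funext fun i => by simpa using congrFun h0 i)
    · rw [zero_smul]
      ext i
      apply Complex.ext
      · rw [toComplexMatrix_mulVec_re]
        simpa using congrFun hA'p i
      · rw [toComplexMatrix_mulVec_im]
        simp [mulVec, dotProduct]
  · refine h (-(ν ^ 2)) (neg_lt_zero.mpr (sq_pos_of_ne_zero hν0))
      ((hasEigenvalue_toLin'_iff _ _).mpr ⟨p, hp0, ?_⟩)
    rw [← mulVec_mulVec, hA'p, mulVec_smul, him, smul_smul]
    congr 1
    ring

/-! ### The equivalence and the instability of the segment -/

theorem theorem3 (n : ℕ) (F H : Matrix (Fin n) (Fin n) ℝ) (b c : Fin n → ℝ) (α₁ α₂ : ℝ)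
    (hrank : H.rank = 1) (hH : H = Matrix.vecMulVec b c)
    (hctrl : IsControllable F b)
    (hunst₁ : IsUnstable (F + α₁ • H)) (hunst₂ : IsUnstable (F + α₂ • H))
    (himag₁ : NoImaginaryEigenvalue (F + α₁ • H))
    (himag₂ : NoImaginaryEigenvalue (F + α₂ • H)) :
    List.TFAE
      [ HasCommonLyapunovMatrix (F + α₁ • H) (F + α₂ • H),
        NoNegativeRealEigenvalue ((F + α₁ • H) * (F + α₂ • H)),
        ∀ ω : ℝ, 0 < 1 - (((α₂ - α₁ : ℝ) : ℂ) *
          transferFunction (F + α₁ • H) b c (Complex.I * (ω : ℂ))).re ] ∧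
    ((HasCommonLyapunovMatrix (F + α₁ • H) (F + α₂ • H) ∨
        NoNegativeRealEigenvalue ((F + α₁ • H) * (F + α₂ • H)) ∨
        ∀ ω : ℝ, 0 < 1 - (((α₂ - α₁ : ℝ) : ℂ) *
          transferFunction (F + α₁ • H) b c (Complex.I * (ω : ℂ))).re) →
      ∀ lam : ℝ, lam ∈ Set.Ioo (0 : ℝ) 1 →
        IsUnstable (F + ((1 - lam) * α₁ + lam * α₂) • H)) := by
  have hA₂ : F + α₂ • H = (F + α₁ • H) + (α₂ - α₁) • Matrix.vecMulVec b c := by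
    rw [hH, sub_smul]
    abel
  have h12 : HasCommonLyapunovMatrix (F + α₁ • H) (F + α₂ • H) →
      NoNegativeRealEigenvalue ((F + α₁ • H) * (F + α₂ • H)) :=
    HasCommonLyapunovMatrix.noNegativeRealEigenvalue_mul
  have h23 : NoNegativeRealEigenvalue ((F + α₁ • H) * (F + α₂ • H)) →
      ∀ ω : ℝ, 0 < 1 - (((α₂ - α₁ : ℝ) : ℂ) *
        transferFunction (F + α₁ • H) b c (Complex.I * (ω : ℂ))).re := by
    rw [hA₂] at himag₂ ⊢
    exact frequency_condition_of_noNegativeRealEigenvalue b c (α₂ - α₁) himag₁ himag₂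
  have h31 : (∀ ω : ℝ, 0 < 1 - (((α₂ - α₁ : ℝ) : ℂ) *
        transferFunction (F + α₁ • H) b c (Complex.I * (ω : ℂ))).re) →
      HasCommonLyapunovMatrix (F + α₁ • H) (F + α₂ • H) := by
    rw [hA₂]
    exact hasCommonLyapunovMatrix_of_frequency_condition b c (α₂ - α₁) himag₁
  refine ⟨?_, ?_⟩
  · tfae_have 1 → 2 := h12
    tfae_have 2 → 3 := h23
    tfae_have 3 → 1 := h31
    tfae_finish
  · intro h lam hlam
    have hP : HasCommonLyapunovMatrix (F + α₁ • H) (F + α₂ • H) := by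
      rcases h with h | h | h
      · exact h
      · exact h31 (h23 h)
      · exact h31 h
    have h1 := hP.isUnstable_convexCombination hunst₁ (sub_pos.mpr hlam.2) hlam.1
    have h2 : F + ((1 - lam) * α₁ + lam * α₂) • H
        = (1 - lam) • (F + α₁ • H) + lam • (F + α₂ • H) := by
      module
    rwa [h2]
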